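/- Let $\mathcal V=\{1,\dots,n\}$ be partitioned into nonempty clusters $\mathcal C_1,\dots,\mathcal C_K$, and let $\Upsilon$ be a set of directed graphs on $\mathcal V$ with property $\mathcal A$: for each pair $p,q$, either no graph of $\Upsilon$ has a link from $\mathcal C_q$ to $\mathcal C_p$, or in every graph of $\Upsilon$ each vertex of $\mathcal C_p$ receives at least one link from $\mathcal C_q$. For a nonnegative matrix $M$ let $\mathcal G(M)$ be the directed graph with a link from $j$ to $i$ iff $M_{ij}>0$. A graph has cluster-spanning-trees if for each $p$ there is a vertex of $\mathcal V$ from which every vertex of $\mathcal C_p$ can be reached along a directed path. Consider $$x_i(t+1)=\sum_{j=1}^n A_{ij}(t)x_j(t)+\alpha_p u(t),\qquad i\in\mathcal C_p,\ p=1,\dots,K,\ t=0,1,2,\dots\qquad(*)$$ with $\alpha\in\mathbb R^K$ and $u$ a real sequence, where the $A(t)$ are $n\times n$ (row-)stochastic matrices with $\mathcal G(A(t))\in\Upsilon$ such that: ($\mathcal B_1$) there is $e>0$ such that for all $i,j,t$ either $A_{ij}(t)=0$ or $A_{ij}(t)\ge e$; ($\mathcal B_2$) $A_{ii}(t)\ge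 e$ for all $i,t$; ($\mathcal B_3^*$) there is a constant $K\times K$ stochastic matrix $B=[b_{pq}]$ with $\sum_{j\in\mathcal C_q}A_{ij}(t)=b_{pq}$ for all $t$, all $p,q$ and all $i\in\mathcal C_p$; and there is an integer $L>0$ such that for every $t\ge 0$ the union graph $\mathcal G\big(\sum_{s=t}^{t+L-1}A(s)\big)$ has cluster-spanning-trees. (1) If $u(t)$ and $\sum_{k=0}^t u(k)$ are bounded, then every solution of $(*)$ is bounded. (2) Let $T\ge 2$. Then $(*)$ with $T$-periodic input of zero period sum reaches cluster consensus generically, in the following sense. Let $\mathcal T$ be the set of triples $(B,\alpha,u)$ in which $B$ is a $K\times K$ stochastic matrix with $b_{pq}>0$ exactly when the graphs of $\Upsilon$ have links from $\mathcal C_q$ to $\mathcal C_p$, $\alpha\in\mathbb R^K$, and $u$ is $T$-periodic with $\sum_{k=0}^{T-1}u(k)=0$. For almost every triple in $\mathcal T$ (with respect to Lebesgue measure in the free coordinates: the off-diagonal entries of $B$ that are not forced to vanish, $\alpha$, and $u(1),\dots,u(T-1)$), for every sequence $A(t)$ as above with inter-cluster influence matrix $B$, and for almost every $x(0)\in\mathbb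 R^n$, the solution of $(*)$ reaches cluster consensus: $x(t)$ is bounded, $\lim_{t\to\infty}|x_i(t)-x_j(t)|=0$ whenever $i,j$ lie in the same cluster, and $\limsup_{t\to\infty}|x_i(t)-x_j(t)|>0$ whenever $i,j$ lie in different clusters. (3) If $T\ge 1$ and $u$ is $T$-periodic with $\sum_{k=0}^{T-1}u(k)=0$, then for every solution $x(t)$ of $(*)$ there is a $T$-periodic solution $v(t)$ of $(*)$ with $\lim_{t\to\infty}(x(t)-v(t))=0$. -/

import Mathlib

open Filter Topology MeasureTheory

namespace ClusterConsensus

/-- The directed graph of a nonnegative matrix: there is a link from `j` to `i` iff `A i j > 0`. -/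
def graphOf {n : ℕ} (A : Matrix (Fin n) (Fin n) ℝ) : Digraph (Fin n) where
  Adj j i := 0 < A i j

/-- `G` has cluster-spanning-trees with respect to the clustering `C_p = {i | c i = p}`: every
cluster has a root, somewhere in the graph, from which each vertex of the cluster can be reached
along a directed path. -/
def HasClusterSpanningTrees {n K : ℕ} (c : Fin n → Fin K) (G : Digraph (Fin n)) : Prop :=
  ∀ p, ∃ r, ∀ i, c i = p → Relation.ReflTransGen G.Adj r i

/-- For each pair of clusters `p`, `q`: either no graph of `Υ` has a link from `C_q` to `C_p`, or
in every graph of `Υ` each vertex of `C_p` receives at least one link from `C_q`. -/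
def UniformClusterLinks {n K : ℕ} (c : Fin n → Fin K) (Υ : Set (Digraph (Fin n))) : Prop :=
  ∀ p q,
    (∀ G ∈ Υ, ∀ i j, c i = p → c j = q → ¬ G.Adj j i) ∨
    (∀ G ∈ Υ, ∀ i, c i = p → ∃ j, c j = q ∧ G.Adj j i)

/-- Some graph of `Υ` has a link from the cluster `q` to the cluster `p`. -/
def ClusterLink {n K : ℕ} (c : Fin n → Fin K) (Υ : Set (Digraph (Fin n))) (p q : Fin K) : Prop :=
  ∃ G ∈ Υ, ∃ i j, c i = p ∧ c j = q ∧ G.Adj j i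

/-- The assumptions on the switching matrices `A 0, A 1, …` with static inter-cluster influence
matrix `B`. -/
structure SwitchingAssumptions {n K : ℕ} (c : Fin n → Fin K) (Υ : Set (Digraph (Fin n)))
    (A : ℕ → Matrix (Fin n) (Fin n) ℝ) (B : Matrix (Fin K) (Fin K) ℝ) : Prop where
  stochastic : ∀ t, A t ∈ Matrix.rowStochastic ℝ (Fin n)
  graph_mem : ∀ t, graphOf (A t) ∈ Υ
  lower_bound : ∃ e : ℝ, 0 < e ∧ (∀ t i j, A t i j = 0 ∨ e ≤ A t i j) ∧ ∀ t i, e ≤ A t i i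
  influence_stochastic : B ∈ Matrix.rowStochastic ℝ (Fin K)
  common_influence : ∀ t p q i, c i = p → ∑ j with c j = q, A t i j = B p q
  spanning : ∃ L : ℕ, 0 < L ∧
    ∀ t, HasClusterSpanningTrees c (graphOf (∑ s ∈ Finset.Ico t (t + L), A s))

/-- `x` solves `x_i(t+1) = ∑_j A_ij(t) x_j(t) + α_p u(t)` for `i` in the cluster `p`. -/
def IsTrajectory {n K : ℕ} (c : Fin n → Fin K) (A : ℕ → Matrix (Fin n) (Fin n) ℝ)
    (α : Fin K → ℝ) (u : ℕ → ℝ) (x : ℕ → Fin n → ℝ) : Prop :=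
  ∀ t i, x (t + 1) i = ∑ j, A t i j * x t j + α (c i) * u t

/-- The input has period `T` and its sum over a period is zero. -/
def ZeroSumPeriodic (T : ℕ) (u : ℕ → ℝ) : Prop :=
  Function.Periodic u T ∧ ∑ k ∈ Finset.range T, u k = 0

/-- Cluster consensus of a trajectory: boundedness, intra-cluster synchronization and
inter-cluster separation (the upper limit is taken in the extended reals). -/
structure ReachesClusterConsensus {n K : ℕ} (c : Fin n → Fin K) (x : ℕ → Fin n → ℝ) : Prop where
  bounded : Bornology.IsBounded (Set.range x)
  synchronizes : ∀ i j, c i = c j → Tendsto (fun t => |x t i - x t j|) atTop (𝓝 0)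
  separates : ∀ i j, c i ≠ c j →
    0 < limsup (fun t => ((|x t i - x t j| : ℝ) : EReal)) atTop

/-- The set of triples `(B, α, u)`: a `K × K` stochastic matrix `B` with `B p q > 0` exactly when
the graphs of `Υ` have links from the cluster `q` to the cluster `p`, a vector `α ∈ ℝ^K`, and a
`T`-periodic input `u` with zero period sum. -/
def parameterSet {n K : ℕ} (c : Fin n → Fin K) (Υ : Set (Digraph (Fin n))) (T : ℕ) :
    Set (Matrix (Fin K) (Fin K) ℝ × (Fin K → ℝ) × (ℕ → ℝ)) :=
  {z | z.1 ∈ Matrix.rowStochastic ℝ (Fin K) ∧ (∀ p q, 0 < z.1 p q ↔ ClusterLink c Υ p q) ∧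
    ZeroSumPeriodic T z.2.2}

/-- The free coordinates of a triple `(B, α, u)`: the off-diagonal entries of `B` that are not
forced to vanish (the diagonal is determined by the row sums), the vector `α`, and the values
`u 1, …, u (T - 1)`. -/
def freeCoordinates {n K : ℕ} (c : Fin n → Fin K) (Υ : Set (Digraph (Fin n))) (T : ℕ)
    (z : Matrix (Fin K) (Fin K) ℝ × (Fin K → ℝ) × (ℕ → ℝ)) :
    ({e : Fin K × Fin K // e.1 ≠ e.2 ∧ ClusterLink c Υ e.1 e.2} → ℝ) × (Fin K → ℝ) ×
      (Fin (T - 1) → ℝ) :=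
  (fun e => z.1 e.1.1 e.1.2, z.2.1, fun k => z.2.2 (k + 1))

open Classical in
/-- `P` holds for almost every triple of the parameter set: the exceptional triples form a
Lebesgue null set in the free coordinates. -/
def ForAlmostEveryTriple {n K : ℕ} (c : Fin n → Fin K) (Υ : Set (Digraph (Fin n))) (T : ℕ)
    (P : Matrix (Fin K) (Fin K) ℝ → (Fin K → ℝ) → (ℕ → ℝ) → Prop) : Prop :=
  volume (freeCoordinates c Υ T '' {z ∈ parameterSet c Υ T | ¬ P z.1 z.2.1 z.2.2}) = 0

end ClusterConsensus

/-! Constant cluster row sums make each `A t` send a cluster-constant vector `y ∘ c` to `(B *ᵥ y) ∘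
c`. So trajectories of the reduced system `y (t + 1) = B *ᵥ y t + u t • α` lift to trajectories, and
the deviation of any trajectory from a lift obeys the homogeneous recursion.

Homogeneous trajectories converge to some `η ∘ c` with `B *ᵥ η = η` (`exists_limit_of_homogeneous`).
Over a long window, two rows of one cluster share a positive column and put equal mass on every
cluster, so spreads inside clusters contract geometrically; from then on the evolution shadows
powers of `B`. These converge on every vector because `B` has positive diagonal; more precisely, the
increments `(B ^ k) *ᵥ (B *ᵥ w - w)` are summable in norm.

Only the reduced system remains. Abel summation against these increments gives boundedness, and the
same series run over an infinite past gives a periodic solution. For separation, fix `B` and `u ≠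
0`: the `α` that fail to separate `p` from `q` lie in a proper subspace
(`synchronizingInputs_ne_top`), hence in a null set, and Fubini covers all parameters. No initial
state needs to be excluded. -/

namespace ClusterConsensus

open Matrix

/-! ### Powers of a stochastic matrix with positive diagonal -/

section PowersOfStochasticMatrices

variable {ι : Type*} [Fintype ι] [DecidableEq ι]

lemma norm_mulVec_le_of_mem_rowStochastic {B : Matrix ι ι ℝ} (hB : B ∈ rowStochastic ℝ ι)
    (v : ι → ℝ) : ‖B *ᵥ v‖ ≤ ‖v‖ := by
  refine (pi_norm_le_iff_of_nonneg (norm_nonneg v)).2 fun i => ?_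
  calc ‖(B *ᵥ v) i‖ ≤ ∑ j, ‖B i j * v j‖ := norm_sum_le _ _
    _ ≤ ∑ j, B i j * ‖v‖ := by
        refine Finset.sum_le_sum fun j _ => ?_
        rw [norm_mul, Real.norm_of_nonneg (nonneg_of_mem_rowStochastic hB)]
        exact mul_le_mul_of_nonneg_left (norm_le_pi_norm v j) (nonneg_of_mem_rowStochastic hB)
    _ = ‖v‖ := by rw [← Finset.sum_mul, sum_row_of_mem_rowStochastic hB, one_mul]

lemma mul_sub_mulVec_apply_le {B : Matrix ι ι ℝ} (hB : B ∈ rowStochastic ℝ ι) {d : ι → ℝ} {b : ℝ}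
    (hd : ∀ j, d j ≤ b) (i : ι) : B i i * (b - d i) ≤ b - (B *ᵥ d) i := by
  have h1 : b - (B *ᵥ d) i = ∑ j, B i j * (b - d j) := by
    simp only [mul_sub, Finset.sum_sub_distrib, ← Finset.sum_mul,
      sum_row_of_mem_rowStochastic hB, one_mul, mulVec, dotProduct]
  rw [h1]
  exact Finset.single_le_sum (f := fun j => B i j * (b - d j))
    (fun j _ => mul_nonneg (nonneg_of_mem_rowStochastic hB) (sub_nonneg.2 (hd j)))
    (Finset.mem_univ i)

/-- The norms of the increments decrease to some `m`. If `m > 0`, a coordinate that is extremal at a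
late time must have been nearly extremal, with the same sign, throughout a long stretch before,
since its diagonal weight is at least `e`. Its increments then add up beyond the bound on `(B ^ k)
*ᵥ w`. -/
lemma pow_mulVec_sub_mulVec_tendsto_zero {B : Matrix ι ι ℝ} (hB : B ∈ rowStochastic ℝ ι)
    (hdiag : ∀ i, 0 < B i i) (w : ι → ℝ) :
    Tendsto (fun k => (B ^ (k + 1)) *ᵥ w - (B ^ k) *ᵥ w) atTop (𝓝 0) := by
  classical
  rcases isEmpty_or_nonempty ι with hι | hι
  · exact tendsto_const_nhds.congr fun k => Subsingleton.elim _ _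
  obtain ⟨i₀, hi₀⟩ := Finite.exists_min fun i => B i i
  set e := B i₀ i₀ with he
  have he0 : 0 < e := hdiag i₀
  have he1 : e ≤ 1 := le_one_of_mem_rowStochastic hB
  set d : ℕ → ι → ℝ := fun k => (B ^ (k + 1)) *ᵥ w - (B ^ k) *ᵥ w with hd
  have hstep : ∀ k, d (k + 1) = B *ᵥ d k := fun k => by
    simp only [hd, mulVec_sub, mulVec_mulVec, ← pow_succ']
  have hanti : Antitone fun k => ‖d k‖ := antitone_nat_of_succ_le fun k => by
    rw [hstep]; exact norm_mulVec_le_of_mem_rowStochastic hB _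
  have hbdd : BddBelow (Set.range fun k => ‖d k‖) := ⟨0, by rintro _ ⟨k, rfl⟩; exact norm_nonneg _⟩
  rw [tendsto_zero_iff_norm_tendsto_zero]
  have hlim := tendsto_atTop_ciInf hanti hbdd
  set m := ⨅ k, ‖d k‖ with hm
  have hmle : ∀ k, m ≤ ‖d k‖ := fun k => ciInf_le hbdd k
  have hm0 : 0 ≤ m := le_ciInf fun k => norm_nonneg _
  rcases hm0.eq_or_lt with hm0 | hm0
  · rwa [← hm0] at hlim
  exfalso
  -- `N` increments of size `m / 2` exceed `2 * ‖w‖`, the largest possible displacement of a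
  -- coordinate.
  obtain ⟨N, hN⟩ := exists_nat_gt (2 * ‖w‖ / (m / 2))
  rw [div_lt_iff₀ (by positivity)] at hN
  have hε : 0 < e ^ N * (m / 2) := by positivity
  obtain ⟨k₀, hk₀⟩ := ((tendsto_order.1 hlim).2 (m + e ^ N * (m / 2)) (by linarith)).exists
  have hle : ∀ k, k₀ ≤ k → ‖d k‖ ≤ m + e ^ N * (m / 2) := fun k hk => (hanti hk).trans hk₀.le
  obtain ⟨i, hi⟩ : ∃ i, ‖d (k₀ + N) i‖ = ‖d (k₀ + N)‖ := by
    obtain ⟨i, hi⟩ := Finite.exists_max fun i => ‖d (k₀ + N) i‖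
    exact ⟨i, (norm_le_pi_norm _ i).antisymm
      ((pi_norm_le_iff_of_nonneg (norm_nonneg _)).2 hi)⟩
  obtain ⟨σ, hσ, hσi⟩ : ∃ σ : ℝ, |σ| = 1 ∧ σ * d (k₀ + N) i = ‖d (k₀ + N)‖ := by
    rw [← hi]
    rcases le_total 0 (d (k₀ + N) i) with h | h
    · exact ⟨1, by simp, by rw [Real.norm_of_nonneg h, one_mul]⟩
    · exact ⟨-1, by simp, by rw [Real.norm_of_nonpos h]; ring⟩
  have hub : ∀ k, k₀ ≤ k → ∀ j, σ * d k j ≤ m + e ^ N * (m / 2) := fun k hk j => by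
    refine (le_abs_self _).trans ?_
    rw [abs_mul, hσ, one_mul]
    exact (norm_le_pi_norm (d k) j).trans (hle k hk)
  -- Each step back in time enlarges the gap to the upper bound by a factor of at most `1 / e`. The
  -- slack `e ^ N * (m / 2)` keeps the gap below `m / 2` for `N` steps.
  have hback : ∀ j ≤ N, e ^ j * (m + e ^ N * (m / 2) - σ * d (k₀ + (N - j)) i)
      ≤ e ^ N * (m / 2) := by
    intro j
    induction j with
    | zero => intro _; simp only [pow_zero, one_mul, Nat.sub_zero, hσi]; linarith [hmle (k₀ + N)]
    | succ j ih =>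
      intro hj
      have h1 := ih (by omega)
      obtain ⟨q, hq⟩ : ∃ q, N - j = q + 1 := ⟨N - j - 1, by omega⟩
      have hq' : N - (j + 1) = q := by omega
      rw [hq', pow_succ, mul_assoc]
      rw [hq, ← add_assoc, hstep] at h1
      refine le_trans (mul_le_mul_of_nonneg_left ?_ (by positivity)) h1
      have h2 := mul_sub_mulVec_apply_le hB (d := σ • d (k₀ + q)) (hub (k₀ + q) (by omega)) i
      rw [mulVec_smul] at h2
      simp only [Pi.smul_apply, smul_eq_mul] at h2
      refine le_trans (mul_le_mul_of_nonneg_right (hi₀ i) ?_) h2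
      linarith [hub (k₀ + q) (by omega) i]
  have hlow : ∀ j ≤ N, m / 2 ≤ σ * d (k₀ + j) i := by
    intro j hj
    have h1 := hback (N - j) (by omega)
    rw [show N - (N - j) = j by omega] at h1
    have h2 : e ^ (N - j) * (m + e ^ N * (m / 2) - σ * d (k₀ + j) i) ≤ e ^ (N - j) * (m / 2) :=
      h1.trans (mul_le_mul_of_nonneg_right
        (pow_le_pow_of_le_one he0.le he1 (by omega)) (by positivity))
    have h3 := le_of_mul_le_mul_left h2 (by positivity)
    linarith
  have hsum : ∑ j ∈ Finset.range N, σ * d (k₀ + j) i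
      = σ * (((B ^ (k₀ + N)) *ᵥ w) i - ((B ^ k₀) *ᵥ w) i) := by
    rw [← Finset.mul_sum]
    simpa [hd, add_assoc] using
      congrArg (σ * ·) (Finset.sum_range_sub (fun j => ((B ^ (k₀ + j)) *ᵥ w) i) N)
  have hge : (N : ℝ) * (m / 2) ≤ ∑ j ∈ Finset.range N, σ * d (k₀ + j) i := by
    simpa using Finset.card_nsmul_le_sum (Finset.range N) (fun j => σ * d (k₀ + j) i) (m / 2)
      fun j hj => hlow j (Finset.mem_range.1 hj).le
  have hpow : ∀ k, |((B ^ k) *ᵥ w) i| ≤ ‖w‖ := fun k =>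
    (norm_le_pi_norm ((B ^ k) *ᵥ w) i).trans
      (norm_mulVec_le_of_mem_rowStochastic (pow_mem hB k) w)
  have hfin : σ * (((B ^ (k₀ + N)) *ᵥ w) i - ((B ^ k₀) *ᵥ w) i) ≤ 2 * ‖w‖ := by
    refine (le_abs_self _).trans ?_
    rw [abs_mul, hσ, one_mul, two_mul]
    exact (abs_sub _ _).trans (add_le_add (hpow _) (hpow _))
  linarith

lemma summable_of_contracting_shift {f : ℕ → ℝ} (hf : ∀ k, 0 ≤ f k) {N : ℕ}
    (hN : ∀ k, f (k + N) ≤ f k / 2) : Summable f := by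
  refine summable_of_sum_range_le (c := 2 * ∑ k ∈ Finset.range N, f k) hf fun n => ?_
  have h1 : ∑ k ∈ Finset.range n, f k ≤ ∑ k ∈ Finset.range (N + n), f k :=
    Finset.sum_le_sum_of_subset_of_nonneg (Finset.range_mono (by omega)) fun k _ _ => hf k
  have h2 : ∑ k ∈ Finset.range n, f (N + k) ≤ (∑ k ∈ Finset.range n, f k) / 2 := by
    rw [Finset.sum_div]
    exact Finset.sum_le_sum fun k _ => by rw [add_comm]; exact hN k
  rw [Finset.sum_range_add] at h1
  linarith

/-- `G` extends a linear section of `M` over its range to the whole space. -/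
lemma exists_mul_mul_self_eq_self (M : Matrix ι ι ℝ) : ∃ G : Matrix ι ι ℝ, M * G * M = M := by
  set f := toLin' M with hf
  obtain ⟨g, hg⟩ := f.rangeRestrict.exists_rightInverse_of_surjective f.range_rangeRestrict
  obtain ⟨g', hg'⟩ := LinearMap.exists_extend g
  refine ⟨LinearMap.toMatrix' g', ?_⟩
  apply toLin'.injective
  rw [toLin'_mul, toLin'_mul, toLin'_toMatrix', ← hf]
  refine LinearMap.ext fun v => ?_
  have h1 : g' (f v) = g (f.rangeRestrict v) := by rw [← hg']; rfl
  have h2 := congrArg Subtype.val (LinearMap.congr_fun hg (f.rangeRestrict v))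
  simp only [LinearMap.comp_apply, h1]
  simpa using h2

-- With `(B - 1) * G * (B - 1) = B - 1`, the matrices `M k = B ^ k * (B - 1)` satisfy `M (k + m) = M
-- k * G * M m`. Since `M` tends to zero, some shift at least halves the norm, so mere convergence
-- upgrades to summability.
attribute [local instance] Matrix.linftyOpNormedRing in
lemma summable_norm_pow_mulVec_sub {B : Matrix ι ι ℝ} (hB : B ∈ rowStochastic ℝ ι)
    (hdiag : ∀ i, 0 < B i i) (w : ι → ℝ) :
    Summable fun k => ‖(B ^ k) *ᵥ (B *ᵥ w - w)‖ := by
  obtain ⟨G, hG⟩ := exists_mul_mul_self_eq_self (B - 1)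
  set M : ℕ → Matrix ι ι ℝ := fun k => B ^ k * (B - 1) with hM
  have hadd : ∀ k m, M (k + m) = M k * G * M m := fun k m => by
    have hc : Commute (B ^ m) (B - 1) := ((Commute.refl B).sub_right (Commute.one_right B)).pow_left m
    calc M (k + m) = B ^ k * (B ^ m * (B - 1)) := by simp only [hM, pow_add, mul_assoc]
      _ = B ^ k * ((B - 1) * G * (B - 1) * B ^ m) := by rw [hc.eq, hG]
      _ = M k * G * M m := by simp only [hM, mul_assoc, hc.eq]
  have htend : Tendsto M atTop (𝓝 0) := by
    refine tendsto_pi_nhds.2 fun i => tendsto_pi_nhds.2 fun j => ?_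
    have h1 := tendsto_pi_nhds.1 (pow_mulVec_sub_mulVec_tendsto_zero hB hdiag (Pi.single j 1)) i
    refine h1.congr fun k => ?_
    simp [hM, mul_sub, pow_succ]
  have htend' : Tendsto (fun k => ‖G‖ * ‖M k‖) atTop (𝓝 0) := by
    simpa using (tendsto_zero_iff_norm_tendsto_zero.1 htend).const_mul ‖G‖
  obtain ⟨N, hN⟩ := (htend'.eventually_lt_const (by norm_num : (0 : ℝ) < 1 / 2)).exists
  have hsum : Summable fun k => ‖M k‖ := by
    refine summable_of_contracting_shift (fun k => norm_nonneg _) (N := N) fun k => ?_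
    calc ‖M (k + N)‖ ≤ ‖M k‖ * (‖G‖ * ‖M N‖) := by
          rw [hadd, mul_assoc]
          exact (norm_mul_le _ _).trans (mul_le_mul_of_nonneg_left (norm_mul_le _ _) (norm_nonneg _))
      _ ≤ ‖M k‖ * (1 / 2) := mul_le_mul_of_nonneg_left hN.le (norm_nonneg _)
      _ = ‖M k‖ / 2 := by ring
  refine Summable.of_nonneg_of_le (fun k => norm_nonneg _) (fun k => ?_) (hsum.mul_right ‖w‖)
  have h1 : (B ^ k) *ᵥ (B *ᵥ w - w) = M k *ᵥ w := by
    simp [hM, ← mulVec_mulVec, sub_mulVec]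
  rw [h1]
  exact linfty_opNorm_mulVec _ _

end PowersOfStochasticMatrices

/-! ### Products of the switching matrices -/

/-- The product `A (t + m - 1) * ⋯ * A t`. -/
def transition {ι : Type*} [Fintype ι] [DecidableEq ι] (A : ℕ → Matrix ι ι ℝ) :
    ℕ → ℕ → Matrix ι ι ℝ
  | _, 0 => 1
  | t, m + 1 => transition A (t + 1) m * A t

section Transition

variable {ι : Type*} [Fintype ι] [DecidableEq ι] {A : ℕ → Matrix ι ι ℝ}

lemma transition_succ (t m : ℕ) : transition A t (m + 1) = transition A (t + 1) m * A t := rfl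

lemma transition_add (t a b : ℕ) :
    transition A t (a + b) = transition A (t + a) b * transition A t a := by
  induction a generalizing t with
  | zero => simp [transition]
  | succ a ih =>
    rw [show a + 1 + b = a + b + 1 by ring, transition_succ, transition_succ, ih, mul_assoc,
      show t + 1 + a = t + (a + 1) by ring]

lemma transition_mulVec {z : ℕ → ι → ℝ} (hz : ∀ t, z (t + 1) = A t *ᵥ z t) (t m : ℕ) :
    transition A t m *ᵥ z t = z (t + m) := by
  induction m generalizing t with
  | zero => simp [transition]
  | succ m ih => rw [transition_succ, ← mulVec_mulVec, ← hz, ih]; congr 1; ring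

lemma transition_mem_rowStochastic (hA : ∀ t, A t ∈ rowStochastic ℝ ι) (t m : ℕ) :
    transition A t m ∈ rowStochastic ℝ ι := by
  induction m generalizing t with
  | zero => exact one_mem _
  | succ m ih => exact mul_mem (ih _) (hA _)

lemma mul_apply_le_mul_apply {X Y : Matrix ι ι ℝ} (hX : X ∈ rowStochastic ℝ ι)
    (hY : Y ∈ rowStochastic ℝ ι) (i k j : ι) : X i k * Y k j ≤ (X * Y) i j :=
  Finset.single_le_sum (f := fun k => X i k * Y k j)
    (fun _ _ => mul_nonneg (nonneg_of_mem_rowStochastic hX) (nonneg_of_mem_rowStochastic hY))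
    (Finset.mem_univ k)

lemma transition_eq_zero_or_le {e : ℝ} (he : 0 < e)
    (hA : ∀ t, A t ∈ rowStochastic ℝ ι) (hAe : ∀ t i j, A t i j = 0 ∨ e ≤ A t i j) (t m : ℕ)
    (i j : ι) : transition A t m i j = 0 ∨ e ^ m ≤ transition A t m i j := by
  induction m generalizing t i j with
  | zero =>
    rcases eq_or_ne i j with rfl | h
    · right; simp [transition]
    · left; simp [transition, h]
  | succ m ih =>
    by_cases h : ∃ k, transition A (t + 1) m i k ≠ 0 ∧ A t k j ≠ 0
    · obtain ⟨k, h1, h2⟩ := h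
      right
      refine le_trans ?_ (mul_apply_le_mul_apply (transition_mem_rowStochastic hA _ _) (hA t) i k j)
      exact mul_le_mul ((ih _ _ _).resolve_left h1) ((hAe _ _ _).resolve_left h2) he.le
        (nonneg_of_mem_rowStochastic (transition_mem_rowStochastic hA _ _))
    · left
      push Not at h
      refine Finset.sum_eq_zero fun k _ => ?_
      by_cases h1 : transition A (t + 1) m i k = 0
      · simp [h1]
      · simp [h k h1]

lemma transition_diag_pos (hA : ∀ t, A t ∈ rowStochastic ℝ ι) (hd : ∀ t i, 0 < A t i i) (t m : ℕ)
    (i : ι) : 0 < transition A t m i i := by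
  induction m generalizing t with
  | zero => simp [transition]
  | succ m ih =>
    exact (mul_pos (ih _) (hd t i)).trans_le
      (mul_apply_le_mul_apply (transition_mem_rowStochastic hA _ _) (hA t) i i i)

/-- Positive diagonals carry a single link through the rest of the window. -/
lemma transition_pos_of_pos (hA : ∀ t, A t ∈ rowStochastic ℝ ι) (hd : ∀ t i, 0 < A t i i)
    {t m s : ℕ} (hs : s ∈ Finset.Ico t (t + m)) {i j : ι} (hij : 0 < A s i j) :
    0 < transition A t m i j := by
  induction m generalizing t with
  | zero => simp at hs
  | succ m ih =>
    rw [Finset.mem_Ico] at hs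
    rcases hs.1.eq_or_lt with rfl | hlt
    · exact (mul_pos (transition_diag_pos hA hd _ _ i) hij).trans_le
        (mul_apply_le_mul_apply (transition_mem_rowStochastic hA _ _) (hA _) i i j)
    · exact (mul_pos (ih (Finset.mem_Ico.2 ⟨hlt, by omega⟩)) (hd t j)).trans_le
        (mul_apply_le_mul_apply (transition_mem_rowStochastic hA _ _) (hA _) i j j)

end Transition

/-! ### Common sources for vertices of one cluster -/

section Scrambling

variable {n K : ℕ} {c : Fin n → Fin K} {A : ℕ → Matrix (Fin n) (Fin n) ℝ}

/-- Following a path from the root backwards never leaves a set closed under in-links. One `r`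
serves all such sets, which is what makes two row supports meet. -/
lemma exists_mem_of_closed {L t : ℕ}
    (hspan : HasClusterSpanningTrees c (graphOf (∑ s ∈ Finset.Ico t (t + L), A s))) (p : Fin K) :
    ∃ r, ∀ S : Finset (Fin n),
      (∀ k l, l ∈ S → ∀ s ∈ Finset.Ico t (t + L), 0 < A s l k → k ∈ S) →
      ∀ i ∈ S, c i = p → r ∈ S := by
  obtain ⟨r, hr⟩ := hspan p
  refine ⟨r, fun S hS i hi hip => ?_⟩
  have key : ∀ a b, Relation.ReflTransGen
      (graphOf (∑ s ∈ Finset.Ico t (t + L), A s)).Adj a b → b ∈ S → a ∈ S := by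
    intro a b hab
    induction hab using Relation.ReflTransGen.head_induction_on with
    | refl => exact id
    | @head a b' h _ ih =>
      intro hb
      have h1 : 0 < ∑ s ∈ Finset.Ico t (t + L), A s b' a := by
        have : 0 < (∑ s ∈ Finset.Ico t (t + L), A s) b' a := h
        rwa [Matrix.sum_apply] at this
      obtain ⟨s, hs, hpos⟩ := Finset.exists_lt_of_sum_lt (s := Finset.Ico t (t + L))
        (f := fun _ => (0 : ℝ)) (g := fun s => A s b' a) (by simpa using h1)
      exact hS a b' (ih hb) s hs hpos
  exact key r i (hr i hip) hi

/-- Row supports only grow when a window is added. If neither the support of row `i` nor that of row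
`j` grows, both are closed under the in-links of that window and contain the root of the common
cluster. Otherwise the sum of their sizes increases; it is at most `2 * n`, so `2 * n + 1` windows
suffice. -/
lemma exists_common_source (hA : ∀ t, A t ∈ rowStochastic ℝ (Fin n)) (hd : ∀ t i, 0 < A t i i)
    {L : ℕ} (hspan : ∀ t, HasClusterSpanningTrees c (graphOf (∑ s ∈ Finset.Ico t (t + L), A s)))
    (t : ℕ) {i j : Fin n} (hij : c i = c j) :
    ∃ k, 0 < transition A t ((2 * n + 1) * L) i k ∧ 0 < transition A t ((2 * n + 1) * L) j k := by
  classical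
  let supp : Matrix (Fin n) (Fin n) ℝ → Fin n → Finset (Fin n) :=
    fun Φ i => Finset.univ.filter fun k => 0 < Φ i k
  have hsupp : ∀ Φ i k, k ∈ supp Φ i ↔ 0 < Φ i k := by simp [supp]
  have key : ∀ h t, (∃ k, 0 < transition A t (h * L) i k ∧ 0 < transition A t (h * L) j k) ∨
      h ≤ (supp (transition A t (h * L)) i).card + (supp (transition A t (h * L)) j).card := by
    intro h
    induction h with
    | zero => intro t; right; omega
    | succ h ih =>
      intro t
      set Φ := transition A (t + L) (h * L) with hΦ
      set Ψ := transition A t ((h + 1) * L) with hΨ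
      -- The new window is added at the early end, so it acts on columns and extends row supports
      -- along in-links.
      have hmul : Ψ = Φ * transition A t L := by
        rw [hΨ, hΦ, ← transition_add]; congr 1; ring
      have hpos : ∀ a b k, 0 < Φ a b → 0 < transition A t L b k → 0 < Ψ a k := by
        intro a b k h1 h2
        rw [hmul]
        exact (mul_pos h1 h2).trans_le (mul_apply_le_mul_apply
          (transition_mem_rowStochastic hA _ _) (transition_mem_rowStochastic hA _ _) a b k)
      have hmono : ∀ a, supp Φ a ⊆ supp Ψ a := fun a k hk => (hsupp _ _ _).2
        (hpos a k k ((hsupp _ _ _).1 hk) (transition_diag_pos hA hd _ _ _))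
      have hself : ∀ a, a ∈ supp Φ a := fun a => (hsupp _ _ _).2 (transition_diag_pos hA hd _ _ _)
      rcases ih (t + L) with ⟨k, h1, h2⟩ | hcard
      · exact Or.inl ⟨k, (hsupp _ _ _).1 (hmono i ((hsupp _ _ _).2 h1)),
          (hsupp _ _ _).1 (hmono j ((hsupp _ _ _).2 h2))⟩
      by_cases heq : supp Φ i = supp Ψ i ∧ supp Φ j = supp Ψ j
      · left
        obtain ⟨r, hr⟩ := exists_mem_of_closed (hspan t) (c i)
        have hclosed : ∀ a, supp Φ a = supp Ψ a → ∀ k l, l ∈ supp Φ a →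
            ∀ s ∈ Finset.Ico t (t + L), 0 < A s l k → k ∈ supp Φ a := by
          intro a ha k l hl s hs hlk
          rw [ha]
          exact (hsupp _ _ _).2 (hpos a l k ((hsupp _ _ _).1 hl) (transition_pos_of_pos hA hd hs hlk))
        exact ⟨r,
          (hsupp _ _ _).1 (hmono i (hr _ (hclosed i heq.1) i (hself i) rfl)),
          (hsupp _ _ _).1 (hmono j (hr _ (hclosed j heq.2) j (hself j) hij.symm))⟩
      · right
        have hi := Finset.card_le_card (hmono i)
        have hj := Finset.card_le_card (hmono j)
        rw [← hΦ] at hcard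
        rw [not_and_or] at heq
        rcases heq with heq | heq
        · have := Finset.card_lt_card ((hmono i).ssubset_of_ne heq)
          omega
        · have := Finset.card_lt_card ((hmono j).ssubset_of_ne heq)
          omega
  refine (key (2 * n + 1) t).resolve_right fun hcard => ?_
  have h1 := Finset.card_le_univ (supp (transition A t ((2 * n + 1) * L)) i)
  have h2 := Finset.card_le_univ (supp (transition A t ((2 * n + 1) * L)) j)
  simp only [Fintype.card_fin] at h1 h2
  omega

end Scrambling

/-! ### Contraction of spreads inside clusters -/

section Contraction

variable {n K : ℕ} {c : Fin n → Fin K}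

lemma sum_comp_mul_eq (c : Fin n → Fin K) (a : Fin n → ℝ) (w : Fin K → ℝ) :
    ∑ k, a k * w (c k) = ∑ q, (∑ k with c k = q, a k) * w q := by
  rw [← Finset.sum_fiberwise Finset.univ c]
  refine Finset.sum_congr rfl fun q _ => ?_
  rw [Finset.sum_mul]
  exact Finset.sum_congr rfl fun k hk => by rw [(Finset.mem_filter.1 hk).2]

/-- A Dobrushin estimate: as `a` and `b` have equal mass on each cluster, subtracting the cluster
minimum from `z` does not change the difference. The new values lie in `[0, D]`, and the overlap of
`a` and `b`, of mass at least `δ`, cancels. -/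
lemma sum_mul_sub_sum_mul_le {a b z : Fin n → ℝ} {D δ : ℝ} (hc : Function.Surjective c)
    (ha : ∀ k, 0 ≤ a k) (hb : ∀ k, 0 ≤ b k) (ha1 : ∑ k, a k = 1)
    (hab : ∀ q, ∑ k with c k = q, a k = ∑ k with c k = q, b k)
    (hδ : ∃ k, δ ≤ a k ∧ δ ≤ b k) (hz : ∀ k l, c k = c l → |z k - z l| ≤ D) :
    ∑ k, a k * z k - ∑ k, b k * z k ≤ (1 - δ) * D := by
  have hmin : ∀ q, ∃ r, c r = q ∧ ∀ k, c k = q → z r ≤ z k := fun q => by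
    obtain ⟨r₀, hr₀⟩ := hc q
    obtain ⟨r, hr, hmin⟩ := Finset.exists_min_image (Finset.univ.filter fun k => c k = q) z
      ⟨r₀, by simp [hr₀]⟩
    exact ⟨r, by simpa using hr, fun k hk => hmin k (by simp [hk])⟩
  choose r hr hrmin using hmin
  have hy0 : ∀ k, 0 ≤ z k - z (r (c k)) := fun k => sub_nonneg.2 (hrmin _ k rfl)
  have hyD : ∀ k, z k - z (r (c k)) ≤ D := fun k => (le_abs_self _).trans (hz _ _ (hr _).symm)
  obtain ⟨k₀, hk₀a, hk₀b⟩ := hδ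
  have hD : 0 ≤ D := (hy0 k₀).trans (hyD k₀)
  have hminsum : δ ≤ ∑ k, min (a k) (b k) := (le_min hk₀a hk₀b).trans
    (Finset.single_le_sum (f := fun k => min (a k) (b k)) (fun k _ => le_min (ha k) (hb k))
      (Finset.mem_univ k₀))
  calc ∑ k, a k * z k - ∑ k, b k * z k
      = ∑ k, (a k - b k) * (z k - z (r (c k))) := by
        have h1 := sum_comp_mul_eq c a fun q => z (r q)
        have h2 := sum_comp_mul_eq c b fun q => z (r q)
        simp only [hab] at h1
        simp only [sub_mul, mul_sub, Finset.sum_sub_distrib]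
        linarith
    _ ≤ ∑ k, (a k - min (a k) (b k)) * D := by
        refine Finset.sum_le_sum fun k _ => ?_
        exact (mul_le_mul_of_nonneg_right (sub_le_sub_left (min_le_right _ _) _) (hy0 k)).trans
          (mul_le_mul_of_nonneg_left (hyD k) (sub_nonneg.2 (min_le_left _ _)))
    _ = (1 - ∑ k, min (a k) (b k)) * D := by
        rw [← Finset.sum_mul, Finset.sum_sub_distrib, ha1]
    _ ≤ (1 - δ) * D := mul_le_mul_of_nonneg_right (by linarith) hD

end Contraction

/-! ### Reduction to the system on the clusters -/

section Reduction

variable {n K : ℕ} {c : Fin n → Fin K} {Υ : Set (Digraph (Fin n))}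
  {A : ℕ → Matrix (Fin n) (Fin n) ℝ} {B : Matrix (Fin K) (Fin K) ℝ}

lemma SwitchingAssumptions.diag_pos (h : SwitchingAssumptions c Υ A B) (t : ℕ) (i : Fin n) :
    0 < A t i i := by
  obtain ⟨e, he, -, hdiag⟩ := h.lower_bound
  exact he.trans_le (hdiag t i)

lemma SwitchingAssumptions.influence_diag_pos (h : SwitchingAssumptions c Υ A B)
    (hc : Function.Surjective c) (p : Fin K) : 0 < B p p := by
  obtain ⟨i, hi⟩ := hc p
  rw [← h.common_influence 0 p p i hi]
  exact (h.diag_pos 0 i).trans_le (Finset.single_le_sum (f := fun j => A 0 i j)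
    (fun j _ => nonneg_of_mem_rowStochastic (h.stochastic 0)) (by simp [hi]))

lemma SwitchingAssumptions.mulVec_comp (h : SwitchingAssumptions c Υ A B) (t : ℕ)
    (y : Fin K → ℝ) : A t *ᵥ (y ∘ c) = (B *ᵥ y) ∘ c := by
  ext i
  have h1 := sum_comp_mul_eq c (A t i) y
  simp only [h.common_influence t (c i) _ i rfl] at h1
  exact h1

lemma SwitchingAssumptions.transition_mulVec_comp (h : SwitchingAssumptions c Υ A B) (t m : ℕ)
    (y : Fin K → ℝ) : transition A t m *ᵥ (y ∘ c) = ((B ^ m) *ᵥ y) ∘ c := by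
  induction m generalizing t y with
  | zero => simp [transition]
  | succ m ih => rw [transition_succ, ← mulVec_mulVec, h.mulVec_comp, ih, mulVec_mulVec, pow_succ]

lemma SwitchingAssumptions.sum_transition (h : SwitchingAssumptions c Υ A B) (t m : ℕ)
    (i : Fin n) (q : Fin K) : ∑ k with c k = q, transition A t m i k = (B ^ m) (c i) q := by
  have h1 := congrFun (h.transition_mulVec_comp t m (Pi.single q 1)) i
  simp only [mulVec_single_one, Function.comp_apply, Matrix.col_apply] at h1
  rw [← h1, Finset.sum_filter]
  simp [mulVec, dotProduct, Pi.single_apply]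

lemma SwitchingAssumptions.exists_contraction (h : SwitchingAssumptions c Υ A B)
    (hc : Function.Surjective c) : ∃ (N : ℕ) (r : ℝ), 0 ≤ r ∧ r < 1 ∧
      ∀ (t : ℕ) (z : Fin n → ℝ) (D : ℝ), (∀ k l, c k = c l → |z k - z l| ≤ D) →
        ∀ i j, c i = c j →
          |(transition A t N *ᵥ z) i - (transition A t N *ᵥ z) j| ≤ r * D := by
  obtain ⟨e, he, hAe, -⟩ := h.lower_bound
  obtain ⟨L, -, hspan⟩ := h.spanning
  -- The cap makes the rate nonnegative also for `n = 0`, where nothing forces `e ≤ 1`.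
  set e' := min e 1
  have he' : 0 < e' := lt_min he one_pos
  set N := (2 * n + 1) * L
  refine ⟨N, 1 - e' ^ N, sub_nonneg.2 (pow_le_one₀ he'.le (min_le_right _ _)),
    sub_lt_self _ (by positivity), fun t z D hz => ?_⟩
  have key : ∀ i j, c i = c j →
      (transition A t N *ᵥ z) i - (transition A t N *ᵥ z) j ≤ (1 - e' ^ N) * D := by
    intro i j hij
    have hmem := transition_mem_rowStochastic h.stochastic t N
    obtain ⟨k, hki, hkj⟩ := exists_common_source h.stochastic h.diag_pos hspan t hij
    have hlow := transition_eq_zero_or_le he' h.stochastic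
      (fun t i j => (hAe t i j).imp_right (min_le_left e 1).trans) t N
    exact sum_mul_sub_sum_mul_le hc (fun _ => nonneg_of_mem_rowStochastic hmem)
      (fun _ => nonneg_of_mem_rowStochastic hmem) (sum_row_of_mem_rowStochastic hmem i)
      (fun q => by rw [h.sum_transition, h.sum_transition, hij])
      ⟨k, (hlow i k).resolve_left hki.ne', (hlow j k).resolve_left hkj.ne'⟩ hz
  exact fun i j hij => abs_sub_le_iff.2 ⟨key i j hij, key j i hij.symm⟩

lemma SwitchingAssumptions.tendsto_sub_of_homogeneous (h : SwitchingAssumptions c Υ A B)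
    (hc : Function.Surjective c) {z : ℕ → Fin n → ℝ} (hz : ∀ t, z (t + 1) = A t *ᵥ z t)
    {i j : Fin n} (hij : c i = c j) : Tendsto (fun t => z t i - z t j) atTop (𝓝 0) := by
  obtain ⟨N, r, hr0, hr1, hcontr⟩ := h.exists_contraction hc
  have hbound : ∀ t, ‖z t‖ ≤ ‖z 0‖ := fun t => by
    have h1 := transition_mulVec hz 0 t
    rw [zero_add] at h1
    rw [← h1]
    exact norm_mulVec_le_of_mem_rowStochastic (transition_mem_rowStochastic h.stochastic _ _) _
  have key : ∀ m t, m * N ≤ t → ∀ i j, c i = c j → |z t i - z t j| ≤ r ^ m * (2 * ‖z 0‖) := by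
    intro m
    induction m with
    | zero =>
      intro t _ i j _
      rw [pow_zero, one_mul, two_mul]
      exact (abs_sub _ _).trans (add_le_add ((norm_le_pi_norm (z t) i).trans (hbound t))
        ((norm_le_pi_norm (z t) j).trans (hbound t)))
    | succ m ih =>
      intro t ht i j hij
      rw [add_mul, one_mul] at ht
      have h1 := hcontr (t - N) (z (t - N)) _ (ih (t - N) (by omega)) i j hij
      rw [transition_mulVec hz, show t - N + N = t by omega] at h1
      rwa [pow_succ', mul_assoc]
  have hlim : Tendsto (fun m => r ^ m * (2 * ‖z 0‖)) atTop (𝓝 0) := by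
    simpa using (tendsto_pow_atTop_nhds_zero_of_lt_one hr0 hr1).mul_const (2 * ‖z 0‖)
  rw [Metric.tendsto_atTop]
  intro ε hε
  obtain ⟨m, hm⟩ := (hlim.eventually_lt_const hε).exists
  refine ⟨m * N, fun t ht => ?_⟩
  rw [Real.dist_eq, sub_zero]
  exact (key m t ht i j hij).trans_lt hm

lemma cauchySeq_pow_mulVec {ι : Type*} [Fintype ι] [DecidableEq ι] {B : Matrix ι ι ℝ}
    (hB : B ∈ rowStochastic ℝ ι) (hdiag : ∀ i, 0 < B i i) (w : ι → ℝ) :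
    CauchySeq fun k => (B ^ k) *ᵥ w := by
  refine cauchySeq_of_summable_dist ((summable_norm_pow_mulVec_sub hB hdiag w).congr fun k => ?_)
  rw [dist_comm, dist_eq_norm, mulVec_sub, mulVec_mulVec, Nat.succ_eq_add_one, pow_succ]

/-- At a late time `z` is almost cluster-constant. Stochastic matrices do not expand the error, so
`z` stays close to the lift of an orbit of `B`, which is Cauchy; hence `z` is Cauchy.
Synchronization makes the limit cluster-constant, and passing to the limit in the recursion shows
that `B` fixes it. -/
lemma SwitchingAssumptions.exists_limit_of_homogeneous (h : SwitchingAssumptions c Υ A B)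
    (hc : Function.Surjective c) {z : ℕ → Fin n → ℝ} (hz : ∀ t, z (t + 1) = A t *ᵥ z t) :
    ∃ η : Fin K → ℝ, B *ᵥ η = η ∧ Tendsto z atTop (𝓝 (η ∘ c)) := by
  set ρ := Function.surjInv hc
  have hρ : ∀ p, c (ρ p) = p := Function.surjInv_eq hc
  have hdev : Tendsto (fun t => z t - (z t ∘ ρ) ∘ c) atTop (𝓝 0) :=
    tendsto_pi_nhds.2 fun i => h.tendsto_sub_of_homogeneous hc hz (hρ (c i)).symm
  have hcauchy : CauchySeq z := by
    rw [Metric.cauchySeq_iff']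
    intro ε hε
    obtain ⟨t, ht⟩ := ((tendsto_zero_iff_norm_tendsto_zero.1 hdev).eventually_lt_const
      (by positivity : 0 < ε / 4)).exists
    have happrox : ∀ m, dist (z (t + m)) (((B ^ m) *ᵥ (z t ∘ ρ)) ∘ c) < ε / 4 := fun m => by
      rw [dist_eq_norm, ← h.transition_mulVec_comp t, ← transition_mulVec hz t, ← mulVec_sub]
      exact (norm_mulVec_le_of_mem_rowStochastic
        (transition_mem_rowStochastic h.stochastic _ _) _).trans_lt ht
    obtain ⟨N, hN⟩ := Metric.cauchySeq_iff'.1 (cauchySeq_pow_mulVec h.influence_stochastic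
      (h.influence_diag_pos hc) (z t ∘ ρ)) (ε / 4) (by positivity)
    refine ⟨t + N, fun s hs => ?_⟩
    obtain ⟨m, rfl⟩ : ∃ m, s = t + m := ⟨s - t, by omega⟩
    have h1 : dist (((B ^ m) *ᵥ (z t ∘ ρ)) ∘ c) (((B ^ N) *ᵥ (z t ∘ ρ)) ∘ c) < ε / 4 := by
      refine lt_of_le_of_lt ?_ (hN m (by omega))
      exact (dist_pi_le_iff dist_nonneg).2 fun i => dist_le_pi_dist _ _ (c i)
    calc dist (z (t + m)) (z (t + N))
        ≤ dist (z (t + m)) (((B ^ m) *ᵥ (z t ∘ ρ)) ∘ c)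
          + dist (((B ^ m) *ᵥ (z t ∘ ρ)) ∘ c) (((B ^ N) *ᵥ (z t ∘ ρ)) ∘ c)
          + dist (((B ^ N) *ᵥ (z t ∘ ρ)) ∘ c) (z (t + N)) := dist_triangle4 _ _ _ _
      _ < ε := by
        have h2 := happrox m
        have h3 := happrox N
        rw [dist_comm] at h3
        linarith
  obtain ⟨ζ, hζ⟩ := cauchySeq_tendsto_of_complete hcauchy
  have hζc : ζ = (ζ ∘ ρ) ∘ c := by
    ext i
    have h1 := (tendsto_pi_nhds.1 hζ i).sub (tendsto_pi_nhds.1 hζ (ρ (c i)))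
    exact sub_eq_zero.1 (tendsto_nhds_unique h1
      (h.tendsto_sub_of_homogeneous hc hz (hρ (c i)).symm))
  refine ⟨ζ ∘ ρ, ?_, hζc ▸ hζ⟩
  have h1 : Tendsto (fun t => z (t + 1)) atTop (𝓝 ((B *ᵥ (ζ ∘ ρ)) ∘ c)) := by
    rw [tendsto_iff_norm_sub_tendsto_zero] at hζ ⊢
    refine squeeze_zero (fun _ => norm_nonneg _) (fun t => ?_) hζ
    rw [hz, ← h.mulVec_comp t, ← mulVec_sub, ← hζc]
    exact norm_mulVec_le_of_mem_rowStochastic (h.stochastic t) _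
  have h2 := tendsto_nhds_unique h1 ((tendsto_add_atTop_iff_nat 1).2 hζ)
  ext p
  have h3 := congrFun h2 (ρ p)
  simpa only [Function.comp_apply, hρ] using h3

/-- A trajectory differs from any lifted trajectory of the reduced system on the clusters by a
convergent remainder. -/
lemma SwitchingAssumptions.exists_limit_sub_reduced (h : SwitchingAssumptions c Υ A B)
    (hc : Function.Surjective c) {α : Fin K → ℝ} {u : ℕ → ℝ} {x : ℕ → Fin n → ℝ}
    (hx : IsTrajectory c A α u x) {y : ℕ → Fin K → ℝ} (hy : ∀ t, y (t + 1) = B *ᵥ y t + u t • α) :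
    ∃ η : Fin K → ℝ, B *ᵥ η = η ∧ Tendsto (fun t => x t - y t ∘ c) atTop (𝓝 (η ∘ c)) := by
  refine h.exists_limit_of_homogeneous hc fun t => ?_
  rw [mulVec_sub, h.mulVec_comp]
  ext i
  simp only [Pi.sub_apply, Function.comp_apply, hx t i, hy, Pi.add_apply, Pi.smul_apply,
    smul_eq_mul, mulVec, dotProduct]
  ring

lemma SwitchingAssumptions.isTrajectory_comp (h : SwitchingAssumptions c Υ A B)
    {α : Fin K → ℝ} {u : ℕ → ℝ} {y : ℕ → Fin K → ℝ} (hy : ∀ t, y (t + 1) = B *ᵥ y t + u t • α) :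
    IsTrajectory c A α u fun t => y t ∘ c := by
  intro t i
  have h1 := congrFun (h.mulVec_comp t (y t)) i
  simp only [mulVec, dotProduct, Function.comp_apply] at h1 ⊢
  rw [h1, hy]
  simp [mulVec, dotProduct, mul_comm]

end Reduction

/-! ### Bounded and periodic solutions of the reduced system -/

section ReducedSystem

variable {ι : Type*} [Fintype ι] [DecidableEq ι] {B : Matrix ι ι ℝ}

/-- The trajectory of `y (t + 1) = B y(t) + u(t) α` that starts at the origin. -/
def reducedTrajectory (B : Matrix ι ι ℝ) (α : ι → ℝ) (u : ℕ → ℝ) : ℕ → ι → ℝ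
  | 0 => 0
  | t + 1 => B *ᵥ reducedTrajectory B α u t + u t • α

/-- Abel summation of `∑ u (t - 1 - k) • ((B ^ k) *ᵥ α)`: the input is traded for its partial sums,
and `α` for `B *ᵥ α - α`, whose orbit under `B` is summable. -/
lemma reducedTrajectory_eq (B : Matrix ι ι ℝ) (α : ι → ℝ) (u : ℕ → ℝ) (t : ℕ) :
    reducedTrajectory B α u t = (∑ k ∈ Finset.range t, u k) • α
      + ∑ k ∈ Finset.range t,
          (∑ l ∈ Finset.range (t - 1 - k), u l) • ((B ^ k) *ᵥ (B *ᵥ α - α)) := by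
  induction t with
  | zero => simp [reducedTrajectory]
  | succ t ih =>
    rw [reducedTrajectory, ih, Finset.sum_range_succ u t, Finset.sum_range_succ' _ t, mulVec_add,
      mulVec_sum]
    have h1 : ∀ k, t - 1 - k = t - (k + 1) := fun k => by omega
    simp only [h1, mulVec_smul, mulVec_mulVec, ← pow_succ', pow_zero, one_mulVec, add_smul,
      smul_sub (∑ k ∈ Finset.range t, u k), Nat.sub_zero, Nat.add_sub_cancel]
    generalize ∑ k ∈ Finset.range t, (∑ l ∈ Finset.range (t - (k + 1)), u l) •
      ((B ^ (k + 1)) *ᵥ (B *ᵥ α - α)) = S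
    abel

lemma exists_norm_reducedTrajectory_le (hB : B ∈ rowStochastic ℝ ι) (hdiag : ∀ i, 0 < B i i)
    (α : ι → ℝ) {u : ℕ → ℝ} {C : ℝ} (hu : ∀ t, |∑ k ∈ Finset.range t, u k| ≤ C) :
    ∃ M, ∀ t, ‖reducedTrajectory B α u t‖ ≤ M := by
  have hC : 0 ≤ C := (abs_nonneg _).trans (hu 0)
  have hsum := summable_norm_pow_mulVec_sub hB hdiag α
  refine ⟨C * ‖α‖ + C * ∑' k, ‖(B ^ k) *ᵥ (B *ᵥ α - α)‖, fun t => ?_⟩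
  rw [reducedTrajectory_eq]
  refine (norm_add_le _ _).trans (add_le_add ?_ ((norm_sum_le _ _).trans ?_))
  · rw [norm_smul]
    exact mul_le_mul_of_nonneg_right (hu t) (norm_nonneg _)
  · calc ∑ k ∈ Finset.range t, ‖(∑ l ∈ Finset.range (t - 1 - k), u l) • ((B ^ k) *ᵥ (B *ᵥ α - α))‖
        ≤ ∑ k ∈ Finset.range t, C * ‖(B ^ k) *ᵥ (B *ᵥ α - α)‖ := by
          refine Finset.sum_le_sum fun k _ => ?_
          rw [norm_smul]
          exact mul_le_mul_of_nonneg_right (hu _) (norm_nonneg _)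
      _ ≤ C * ∑' k, ‖(B ^ k) *ᵥ (B *ᵥ α - α)‖ := by
          rw [← Finset.mul_sum]
          exact mul_le_mul_of_nonneg_left
            (hsum.sum_le_tsum _ fun _ _ => norm_nonneg _) hC

lemma ZeroSumPeriodic.periodic_sum_range {T : ℕ} {u : ℕ → ℝ} (hu : ZeroSumPeriodic T u) :
    Function.Periodic (fun t => ∑ k ∈ Finset.range t, u k) T := by
  intro t
  induction t with
  | zero => simpa using hu.2
  | succ t ih =>
    simp only at ih ⊢
    rw [show t + 1 + T = t + T + 1 by ring, Finset.sum_range_succ, Finset.sum_range_succ, ih, hu.1]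

lemma exists_abs_le_of_periodic {T : ℕ} (hT : 0 < T) {s : ℕ → ℝ} (hs : Function.Periodic s T) :
    ∃ C, ∀ t, |s t| ≤ C := by
  refine ⟨∑ k ∈ Finset.range T, |s k|, fun t => ?_⟩
  rw [← hs.map_mod_nat]
  exact Finset.single_le_sum (f := fun k => |s k|) (fun _ _ => abs_nonneg _)
    (Finset.mem_range.2 (Nat.mod_lt t hT))

/-- The partial sums `s` of `u` are periodic, so they extend to negative times. Letting the Abel sum
run over the infinite past gives a convergent series that inherits the period. -/
lemma exists_periodic_reduced (hB : B ∈ rowStochastic ℝ ι) (hdiag : ∀ i, 0 < B i i) (α : ι → ℝ)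
    {T : ℕ} (hT : 0 < T) {u : ℕ → ℝ} (hu : ZeroSumPeriodic T u) :
    ∃ y : ℕ → ι → ℝ, (∀ t, y (t + 1) = B *ᵥ y t + u t • α) ∧ Function.Periodic y T := by
  set s : ℕ → ℝ := fun t => ∑ k ∈ Finset.range t, u k with hs
  have hper : Function.Periodic s T := hu.periodic_sum_range
  obtain ⟨C, hC⟩ := exists_abs_le_of_periodic hT hper
  set β := B *ᵥ α - α with hβ
  have hsummable : ∀ σ : ℕ → ℕ, Summable fun k => s (σ k) • ((B ^ k) *ᵥ β) := fun σ => by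
    refine Summable.of_norm (Summable.of_nonneg_of_le (fun _ => norm_nonneg _) (fun k => ?_)
      ((summable_norm_pow_mulVec_sub hB hdiag α).mul_left C))
    rw [norm_smul]
    exact mul_le_mul_of_nonneg_right (hC _) (norm_nonneg _)
  -- `t + (T - 1) * (k + 1)` represents `t - 1 - k` modulo `T`
  set q : ℕ → ι → ℝ := fun t => ∑' k, s (t + (T - 1) * (k + 1)) • ((B ^ k) *ᵥ β) with hq
  have hqstep : ∀ t, q (t + 1) = B *ᵥ q t + s t • β := by
    intro t
    have h1 : B *ᵥ q t = ∑' k, s (t + (T - 1) * (k + 1)) • ((B ^ (k + 1)) *ᵥ β) := by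
      have h2 := ((hsummable fun k => t + (T - 1) * (k + 1)).hasSum.mapL
        (LinearMap.toContinuousLinearMap (toLin' B))).tsum_eq
      rw [hq]
      refine Eq.trans ?_ (h2.symm.trans (tsum_congr fun k => ?_))
      · simp
      · simp [pow_succ', mulVec_mulVec]
    rw [h1, hq]
    simp only
    rw [(hsummable fun k => t + 1 + (T - 1) * (k + 1)).tsum_eq_zero_add, add_comm]
    congr 1
    · refine tsum_congr fun k => ?_
      have h3 : t + 1 + (T - 1) * (k + 1 + 1) = t + (T - 1) * (k + 1) + T := by
        rw [mul_add _ (k + 1)]; omega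
      rw [h3, hper]
    · have h3 : t + 1 + (T - 1) * (0 + 1) = t + T := by omega
      rw [h3, hper, pow_zero, one_mulVec]
  refine ⟨fun t => s t • α + q t, fun t => ?_, fun t => ?_⟩
  · have h1 : s (t + 1) = s t + u t := Finset.sum_range_succ _ _
    simp only [hqstep, h1, mulVec_add, mulVec_smul, hβ, smul_sub, add_smul]
    abel
  · have h1 : q (t + T) = q t := by
      refine tsum_congr fun k => ?_
      rw [show t + T + (T - 1) * (k + 1) = t + (T - 1) * (k + 1) + T by ring, hper]
    simp only [h1, hper t]

end ReducedSystem

/-! ### Non-separating input vectors form a proper subspace -/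

section Genericity

variable {ι : Type*} [Fintype ι]

lemma reducedTrajectory_add (B : Matrix ι ι ℝ) (α α' : ι → ℝ) (u : ℕ → ℝ) (t : ℕ) :
    reducedTrajectory B (α + α') u t = reducedTrajectory B α u t + reducedTrajectory B α' u t := by
  induction t with
  | zero => simp [reducedTrajectory]
  | succ t ih => simp only [reducedTrajectory, ih, mulVec_add, smul_add]; abel

lemma reducedTrajectory_smul (B : Matrix ι ι ℝ) (a : ℝ) (α : ι → ℝ) (u : ℕ → ℝ) (t : ℕ) :
    reducedTrajectory B (a • α) u t = a • reducedTrajectory B α u t := by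
  induction t with
  | zero => simp [reducedTrajectory]
  | succ t ih => simp only [reducedTrajectory, ih, mulVec_smul, smul_add, smul_comm a]

lemma reducedTrajectory_mulVec (B : Matrix ι ι ℝ) (α : ι → ℝ) (u : ℕ → ℝ) (t : ℕ) :
    reducedTrajectory B (B *ᵥ α) u t = B *ᵥ reducedTrajectory B α u t := by
  induction t with
  | zero => simp [reducedTrajectory]
  | succ t ih => simp only [reducedTrajectory, ih, mulVec_add, mulVec_smul]

/-- The difference of the increments at time `t` of the components `p` and `q` of the reduced
trajectory. -/
def incrementGap (B : Matrix ι ι ℝ) (u : ℕ → ℝ) (p q : ι) (α : ι → ℝ) (t : ℕ) : ℝ :=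
  (reducedTrajectory B α u (t + 1) - reducedTrajectory B α u t) p
    - (reducedTrajectory B α u (t + 1) - reducedTrajectory B α u t) q

/-- Replacing `α` by `B *ᵥ α` amounts to a time shift up to an input term, so comparing the two
isolates the increment of `u`. -/
lemma incrementGap_succ (B : Matrix ι ι ℝ) (u : ℕ → ℝ) (p q : ι) (α : ι → ℝ) (t : ℕ) :
    incrementGap B u p q α (t + 1)
      = incrementGap B u p q (B *ᵥ α) t + (u (t + 1) - u t) * (α p - α q) := by
  simp only [incrementGap, reducedTrajectory_mulVec, ← mulVec_sub]
  have h1 : reducedTrajectory B α u (t + 1 + 1) - reducedTrajectory B α u (t + 1)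
      = B *ᵥ (reducedTrajectory B α u (t + 1) - reducedTrajectory B α u t)
        + (u (t + 1) - u t) • α := by
    rw [mulVec_sub, reducedTrajectory, sub_smul]
    nth_rewrite 2 [reducedTrajectory]
    abel
  rw [h1]
  simp only [Pi.add_apply, Pi.smul_apply, smul_eq_mul]
  ring

/-- The vectors `α` for which the components `p` and `q` of the reduced trajectory have
asymptotically equal increments. -/
def synchronizingInputs (B : Matrix ι ι ℝ) (u : ℕ → ℝ) (p q : ι) : Submodule ℝ (ι → ℝ) where
  carrier := {α | Tendsto (incrementGap B u p q α) atTop (𝓝 0)}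
  add_mem' {α α'} h h' := by
    have h1 := Tendsto.add h h'
    rw [add_zero] at h1
    refine h1.congr fun t => ?_
    simp only [incrementGap, reducedTrajectory_add, Pi.add_apply, Pi.sub_apply]
    ring
  zero_mem' := by
    have h0 : ∀ t, reducedTrajectory B 0 u t = 0 := fun t => by
      simpa using reducedTrajectory_smul B 0 0 u t
    refine tendsto_const_nhds.congr fun t => ?_
    simp [incrementGap, h0]
  smul_mem' a α h := by
    have h1 := Tendsto.const_mul a h
    rw [mul_zero] at h1
    refine h1.congr fun t => ?_
    simp only [incrementGap, reducedTrajectory_smul, Pi.smul_apply, Pi.sub_apply, smul_eq_mul]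
    ring

lemma ZeroSumPeriodic.eq_zero_of_tendsto_increment {T : ℕ} (hT : 0 < T) {u : ℕ → ℝ}
    (hu : ZeroSumPeriodic T u) (h : Tendsto (fun t => u (t + 1) - u t) atTop (𝓝 0)) : u = 0 := by
  have hper : ∀ m t, u (t + m * T) = u t := fun m t => by simpa using hu.1.nat_mul m t
  have hconst : ∀ t, u (t + 1) = u t := by
    intro t
    have hσ : Tendsto (fun m : ℕ => t + m * T) atTop atTop :=
      tendsto_atTop_mono (fun m => (Nat.le_mul_of_pos_right m hT).trans (Nat.le_add_left _ _))
        tendsto_id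
    have h1 := h.comp hσ
    have h2 : Tendsto (fun _ : ℕ => u (t + 1) - u t) atTop (𝓝 0) := h1.congr fun m => by
      simp only [Function.comp_apply]
      rw [show t + m * T + 1 = t + 1 + m * T by ring, hper, hper]
    exact sub_eq_zero.1 (tendsto_nhds_unique tendsto_const_nhds h2)
  have h0 : ∀ t, u t = u 0 := fun t => by
    induction t with
    | zero => rfl
    | succ t ih => rw [hconst, ih]
  have h1 := hu.2
  simp only [h0, Finset.sum_const, Finset.card_range, nsmul_eq_mul] at h1
  have h2 : u 0 = 0 := (mul_eq_zero.1 h1).resolve_left (by exact_mod_cast hT.ne')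
  exact funext fun t => (h0 t).trans h2

/-- If both `Pi.single p 1` and its image under `B` were synchronizing, `incrementGap_succ` would
force `u (t + 1) - u t` to tend to zero. A periodic input with this property is constant, and the
zero sum makes it vanish. -/
lemma synchronizingInputs_ne_top [DecidableEq ι] (B : Matrix ι ι ℝ) {T : ℕ} (hT : 0 < T) {u : ℕ → ℝ}
    (hu : ZeroSumPeriodic T u) (hu0 : u ≠ 0) {p q : ι} (hpq : p ≠ q) :
    synchronizingInputs B u p q ≠ ⊤ := by
  intro htop
  have hall : ∀ α, Tendsto (incrementGap B u p q α) atTop (𝓝 0) := fun α => by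
    have : α ∈ synchronizingInputs B u p q := htop ▸ Submodule.mem_top
    exact this
  refine hu0 (hu.eq_zero_of_tendsto_increment hT ?_)
  have h1 := ((tendsto_add_atTop_iff_nat 1).2 (hall (Pi.single p 1))).sub
    (hall (B *ᵥ Pi.single p 1))
  rw [sub_zero] at h1
  refine h1.congr fun t => ?_
  rw [incrementGap_succ]
  simp [hpq.symm]

lemma volume_synchronizingInputs (B : Matrix ι ι ℝ) {T : ℕ} (hT : 0 < T) {u : ℕ → ℝ}
    (hu : ZeroSumPeriodic T u) (hu0 : u ≠ 0) {p q : ι} (hpq : p ≠ q) :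
    volume (synchronizingInputs B u p q : Set (ι → ℝ)) = 0 := by
  classical
  exact Measure.addHaar_submodule volume _ (synchronizingInputs_ne_top B hT hu hu0 hpq)

end Genericity

/-! ### Boundedness and cluster consensus of trajectories -/

section Separation

variable {n K : ℕ} {c : Fin n → Fin K} {Υ : Set (Digraph (Fin n))}
  {A : ℕ → Matrix (Fin n) (Fin n) ℝ} {B : Matrix (Fin K) (Fin K) ℝ}

lemma tendsto_abs_zero_of_limsup_le {f : ℕ → ℝ}
    (h : limsup (fun t => ((|f t| : ℝ) : EReal)) atTop ≤ 0) : Tendsto f atTop (𝓝 0) := by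
  rw [Metric.tendsto_nhds]
  intro ε hε
  have h1 : limsup (fun t => ((|f t| : ℝ) : EReal)) atTop < (ε : EReal) :=
    h.trans_lt (by exact_mod_cast hε)
  filter_upwards [eventually_lt_of_limsup_lt h1] with t ht
  rw [Real.dist_eq, sub_zero]
  exact_mod_cast ht

lemma SwitchingAssumptions.isBounded_range (h : SwitchingAssumptions c Υ A B)
    (hc : Function.Surjective c) {α : Fin K → ℝ} {u : ℕ → ℝ} {C : ℝ}
    (hu : ∀ t, |∑ k ∈ Finset.range t, u k| ≤ C) {x : ℕ → Fin n → ℝ} (hx : IsTrajectory c A α u x) :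
    Bornology.IsBounded (Set.range x) := by
  obtain ⟨M, hM⟩ := exists_norm_reducedTrajectory_le h.influence_stochastic
    (h.influence_diag_pos hc) α hu
  obtain ⟨η, -, hη⟩ := h.exists_limit_sub_reduced hc hx
    (y := reducedTrajectory B α u) fun t => rfl
  obtain ⟨R, hR⟩ := (Metric.isBounded_range_of_tendsto _ hη).exists_norm_le
  refine isBounded_iff_forall_norm_le.2 ⟨R + M, ?_⟩
  rintro _ ⟨t, rfl⟩
  have h1 := hR _ (Set.mem_range_self t)
  have h2 : ‖reducedTrajectory B α u t ∘ c‖ ≤ M :=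
    (pi_norm_le_iff_of_nonneg ((norm_nonneg _).trans (hM 0))).2 fun i =>
      (norm_le_pi_norm _ (c i)).trans (hM t)
  calc ‖x t‖ = ‖x t - reducedTrajectory B α u t ∘ c + reducedTrajectory B α u t ∘ c‖ := by
        rw [sub_add_cancel]
    _ ≤ R + M := (norm_add_le _ _).trans (add_le_add h1 h2)

lemma SwitchingAssumptions.reachesClusterConsensus (h : SwitchingAssumptions c Υ A B)
    (hc : Function.Surjective c) {T : ℕ} (hT : 0 < T) {α : Fin K → ℝ} {u : ℕ → ℝ}
    (hu : ZeroSumPeriodic T u) (hα : ∀ p q, p ≠ q → α ∉ synchronizingInputs B u p q)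
    {x : ℕ → Fin n → ℝ} (hx : IsTrajectory c A α u x) : ReachesClusterConsensus c x := by
  obtain ⟨C, hC⟩ := exists_abs_le_of_periodic hT hu.periodic_sum_range
  obtain ⟨η, -, hη⟩ := h.exists_limit_sub_reduced hc hx
    (y := reducedTrajectory B α u) fun t => rfl
  refine ⟨h.isBounded_range hc hC hx, fun i j hij => ?_, fun i j hij => ?_⟩
  · have h1 := ((tendsto_pi_nhds.1 hη i).sub (tendsto_pi_nhds.1 hη j)).abs
    simpa [hij] using h1
  · by_contra hlim
    refine hα (c i) (c j) hij ?_
    have h1 := tendsto_abs_zero_of_limsup_le (not_lt.1 hlim)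
    have h2 := h1.sub ((tendsto_pi_nhds.1 hη i).sub (tendsto_pi_nhds.1 hη j))
    -- Taking increments removes the constant `η (c i) - η (c j)`, the only trace of the initial
    -- state.
    have h3 := ((tendsto_add_atTop_iff_nat 1).2 h2).sub h2
    rw [sub_self] at h3
    refine h3.congr fun t => ?_
    simp only [incrementGap, Pi.sub_apply, Function.comp_apply]
    ring

end Separation

/-- Fubini with the middle factor integrated first; that factor will be the space of the vectors
`α`. -/
lemma measure_prod_prod_null {X Y Z : Type*} [MeasurableSpace X] [MeasurableSpace Y]
    [MeasurableSpace Z] {μ : Measure X} {ν : Measure Y} {ρ : Measure Z} [SFinite μ] [SFinite ν]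
    [SFinite ρ] {s : Set (X × Y × Z)} (hs : MeasurableSet s)
    (h : ∀ a, ∀ᵐ z ∂ρ, ν {y | (a, y, z) ∈ s} = 0) : μ.prod (ν.prod ρ) s = 0 := by
  rw [Measure.measure_prod_null hs]
  refine Eventually.of_forall fun a => ?_
  simp only [Pi.zero_apply]
  rw [Measure.prod_apply_symm (measurable_prodMk_left hs)]
  exact (lintegral_congr_ae (h a)).trans lintegral_zero

/-! ### Null sets in the free coordinates -/

section FreeParameters

variable {K : ℕ} (R : Fin K → Fin K → Prop)

open Classical in
/-- The matrix with row sums one and the given off-diagonal entries on the links `R`. -/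
noncomputable def influenceOfFree (b : {e : Fin K × Fin K // e.1 ≠ e.2 ∧ R e.1 e.2} → ℝ) :
    Matrix (Fin K) (Fin K) ℝ :=
  let off : Fin K → Fin K → ℝ := fun p q => if h : p ≠ q ∧ R p q then b ⟨(p, q), h⟩ else 0
  fun p q => if p = q then 1 - ∑ r, off p r else off p q

/-- The `T`-periodic zero-sum input with the given values at `1, …, T - 1`. -/
noncomputable def inputOfFree (T : ℕ) (w : Fin (T - 1) → ℝ) : ℕ → ℝ := fun t =>
  if h : t % T ≠ 0 ∧ t % T - 1 < T - 1 then w ⟨t % T - 1, h.2⟩ else - ∑ k, w k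

lemma continuous_influenceOfFree : Continuous (influenceOfFree R) := by
  refine continuous_pi fun p => continuous_pi fun q => ?_
  have hoff : ∀ p q, Continuous fun b : {e : Fin K × Fin K // e.1 ≠ e.2 ∧ R e.1 e.2} → ℝ =>
      open Classical in if h : p ≠ q ∧ R p q then b ⟨(p, q), h⟩ else 0 := fun p q => by
    split_ifs
    · exact continuous_apply _
    · exact continuous_const
  unfold influenceOfFree
  by_cases hpq : p = q
  · subst hpq
    simp only [if_true]
    exact continuous_const.sub (continuous_finsetSum _ fun r _ => hoff p r)
  · simp only [hpq, if_false]
    exact hoff p q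

lemma continuous_inputOfFree (T t : ℕ) : Continuous fun w => inputOfFree T w t := by
  unfold inputOfFree
  split_ifs
  · exact continuous_apply _
  · exact (continuous_finsetSum _ fun k _ => continuous_apply k).neg

lemma zeroSumPeriodic_inputOfFree {T : ℕ} (hT : 0 < T) (w : Fin (T - 1) → ℝ) :
    ZeroSumPeriodic T (inputOfFree T w) := by
  refine ⟨fun t => by simp [inputOfFree], ?_⟩
  obtain ⟨m, rfl⟩ : ∃ m, T = m + 1 := ⟨T - 1, by omega⟩
  rw [Finset.sum_range_succ', Finset.sum_range]
  have h1 : ∀ k : Fin m, inputOfFree (m + 1) w (k + 1) = w k := fun k => by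
    have h2 : ((k : ℕ) + 1) % (m + 1) = k + 1 := Nat.mod_eq_of_lt (by omega)
    simp [inputOfFree, h2]
  simp only [h1]
  simp [inputOfFree]

lemma inputOfFree_ne_zero {T : ℕ} {w : Fin (T - 1) → ℝ} (hw : w ≠ 0) :
    inputOfFree T w ≠ 0 := by
  contrapose! hw
  ext k
  have h1 := congrFun hw (k + 1)
  have h2 : ((k : ℕ) + 1) % T = k + 1 := Nat.mod_eq_of_lt (by omega)
  simpa [inputOfFree, h2] using h1

lemma inputOfFree_restrict {T : ℕ} (hT : 0 < T) {u : ℕ → ℝ} (hu : ZeroSumPeriodic T u) :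
    inputOfFree T (fun k : Fin (T - 1) => u (k + 1)) = u := by
  ext t
  rw [← hu.1.map_mod_nat t]
  have hlt := Nat.mod_lt t hT
  by_cases h0 : t % T = 0
  · have h1 := hu.2
    rw [show T = T - 1 + 1 by omega, Finset.sum_range_succ', Finset.sum_range] at h1
    simp only [inputOfFree, h0, ne_eq, not_true_eq_false, false_and, dif_neg, not_false_eq_true]
    linarith
  · have h1 : t % T - 1 < T - 1 := by omega
    simp only [inputOfFree, ne_eq, h0, not_false_eq_true, h1, and_self, dif_pos]
    congr 1
    omega

/-- Nonnegativity and the sign pattern force the entries off the links to vanish; the row sums then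
determine the diagonal. -/
lemma influenceOfFree_restrict {B : Matrix (Fin K) (Fin K) ℝ}
    (hB : B ∈ rowStochastic ℝ (Fin K)) (hR : ∀ p q, 0 < B p q ↔ R p q) :
    influenceOfFree R (fun e => B e.1.1 e.1.2) = B := by
  classical
  have hoff : ∀ p q, (if _ : p ≠ q ∧ R p q then B p q else 0) = if p = q then 0 else B p q := by
    intro p q
    by_cases hpq : p = q
    · simp [hpq]
    · by_cases hRpq : R p q
      · simp [hpq, hRpq]
      · have : B p q = 0 := le_antisymm (not_lt.1 fun h => hRpq ((hR p q).1 h))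
          (nonneg_of_mem_rowStochastic hB)
        simp [this]
  ext p q
  simp only [influenceOfFree, hoff]
  split_ifs with hpq
  · subst hpq
    have h1 := sum_row_of_mem_rowStochastic hB p
    rw [← Finset.add_sum_erase _ _ (Finset.mem_univ p)] at h1 ⊢
    have h2 : ∑ r ∈ Finset.univ.erase p, (if p = r then 0 else B p r)
        = ∑ r ∈ Finset.univ.erase p, B p r :=
      Finset.sum_congr rfl fun r hr => if_neg (Finset.ne_of_mem_erase hr).symm
    rw [h2, if_pos rfl]
    linarith
  · rfl

lemma continuous_reducedTrajectory_free (T t : ℕ) :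
    Continuous fun z : ({e : Fin K × Fin K // e.1 ≠ e.2 ∧ R e.1 e.2} → ℝ) × (Fin K → ℝ) ×
      (Fin (T - 1) → ℝ) => reducedTrajectory (influenceOfFree R z.1) z.2.1 (inputOfFree T z.2.2) t := by
  induction t with
  | zero => exact continuous_const
  | succ t ih =>
    exact (((continuous_influenceOfFree R).comp continuous_fst).matrix_mulVec ih).add
      (((continuous_inputOfFree T t).comp (continuous_snd.comp continuous_snd)).smul
        (continuous_fst.comp continuous_snd))

open Classical in
/-- The free coordinates whose reduced trajectory does not separate `p` and `q`. -/
def nonseparatingParameters (T : ℕ) (p q : Fin K) :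
    Set (({e : Fin K × Fin K // e.1 ≠ e.2 ∧ R e.1 e.2} → ℝ) × (Fin K → ℝ) × (Fin (T - 1) → ℝ)) :=
  {z | z.2.1 ∈ synchronizingInputs (influenceOfFree R z.1) (inputOfFree T z.2.2) p q}

lemma measurableSet_nonseparatingParameters (T : ℕ) (p q : Fin K) :
    MeasurableSet (nonseparatingParameters R T p q) := by
  refine measurableSet_tendsto (𝓝 0) (fun t => Continuous.measurable ?_)
  have h1 := (continuous_reducedTrajectory_free R T (t + 1)).sub
    (continuous_reducedTrajectory_free R T t)
  exact ((continuous_apply p).comp h1).sub ((continuous_apply q).comp h1)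

-- For arbitrary free coordinates the rebuilt matrix may have negative entries, but the subspace
-- argument works for every real matrix.
open Classical in
lemma volume_nonseparatingParameters {T : ℕ} (hT : 2 ≤ T) {p q : Fin K} (hpq : p ≠ q) :
    volume (nonseparatingParameters R T p q) = 0 := by
  have hmeas := measurableSet_nonseparatingParameters R T p q
  have hT0 : 0 < T := by omega
  -- This is where `T ≥ 2` enters: in positive dimension `{0}` is null, whereas for `T = 1` the zero
  -- input is the only one.
  have : Nonempty (Fin (T - 1)) := ⟨⟨0, by omega⟩⟩
  have hw : ∀ᵐ w : Fin (T - 1) → ℝ, w ≠ 0 := by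
    rw [ae_iff]
    simp
  have key : ∀ b, ∀ w ≠ 0, volume {α | (b, α, w) ∈ nonseparatingParameters R T p q} = 0 :=
    fun b w hw => volume_synchronizingInputs (influenceOfFree R b) hT0
      (zeroSumPeriodic_inputOfFree hT0 w) (inputOfFree_ne_zero hw) hpq
  have hprod := measure_prod_prod_null (μ := volume) (ν := volume) (ρ := volume) hmeas
    fun b => hw.mono fun w hw => key b w hw
  rwa [Measure.volume_eq_prod, Measure.volume_eq_prod]

end FreeParameters

lemma forAlmostEveryTriple_reachesClusterConsensus {n K : ℕ} {c : Fin n → Fin K}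
    (hc : Function.Surjective c) (Υ : Set (Digraph (Fin n))) {T : ℕ} (hT : 2 ≤ T) :
    ForAlmostEveryTriple c Υ T fun B α u =>
      ∀ A : ℕ → Matrix (Fin n) (Fin n) ℝ, SwitchingAssumptions c Υ A B →
      ∀ x : ℕ → Fin n → ℝ, IsTrajectory c A α u x → ReachesClusterConsensus c x := by
  classical
  have hnull : volume (⋃ (p : Fin K) (q : Fin K) (_ : p ≠ q),
      nonseparatingParameters (ClusterLink c Υ) T p q) = 0 := by
    simp only [measure_iUnion_null_iff]
    exact fun p q hpq => volume_nonseparatingParameters _ hT hpq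
  refine measure_mono_null ?_ hnull
  rintro _ ⟨⟨B, α, u⟩, ⟨⟨hB, hlink, hu⟩, hbad⟩, rfl⟩
  by_contra hgood
  refine hbad fun A h x hx => h.reachesClusterConsensus hc (by omega) hu (fun p q hpq hα => ?_) hx
  refine hgood (Set.mem_iUnion₂.2 ⟨p, q, Set.mem_iUnion.2 ⟨hpq, ?_⟩⟩)
  change α ∈ synchronizingInputs (influenceOfFree (ClusterLink c Υ) fun e => B e.1.1 e.1.2)
    (inputOfFree T fun k => u (k + 1)) p q
  rwa [influenceOfFree_restrict _ hB hlink, inputOfFree_restrict (by omega) hu]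

end ClusterConsensus

theorem theorem4 {n K : ℕ} (c : Fin n → Fin K) (hc : Function.Surjective c)
    (Υ : Set (Digraph (Fin n))) (hΥ : ClusterConsensus.UniformClusterLinks c Υ) :
    -- bounded inputs with bounded partial sums give bounded solutions
    (∀ (A : ℕ → Matrix (Fin n) (Fin n) ℝ) (B : Matrix (Fin K) (Fin K) ℝ),
      ClusterConsensus.SwitchingAssumptions c Υ A B →
      ∀ (α : Fin K → ℝ) (u : ℕ → ℝ), Bornology.IsBounded (Set.range u) →
      Bornology.IsBounded (Set.range fun t : ℕ => ∑ k ∈ Finset.range (t + 1), u k) →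
      ∀ x : ℕ → Fin n → ℝ, ClusterConsensus.IsTrajectory c A α u x →
        Bornology.IsBounded (Set.range x)) ∧
    -- for periodic inputs with zero period sum: generic cluster consensus
    (∀ T : ℕ, 2 ≤ T → ClusterConsensus.ForAlmostEveryTriple c Υ T fun B α u =>
      ∀ A : ℕ → Matrix (Fin n) (Fin n) ℝ, ClusterConsensus.SwitchingAssumptions c Υ A B →
      ∀ᵐ x₀ : Fin n → ℝ, ∀ x : ℕ → Fin n → ℝ, ClusterConsensus.IsTrajectory c A α u x →
        x 0 = x₀ → ClusterConsensus.ReachesClusterConsensus c x) ∧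
    -- and every trajectory converges to a periodic trajectory
    (∀ (A : ℕ → Matrix (Fin n) (Fin n) ℝ) (B : Matrix (Fin K) (Fin K) ℝ),
      ClusterConsensus.SwitchingAssumptions c Υ A B →
      ∀ (T : ℕ) (α : Fin K → ℝ) (u : ℕ → ℝ), 0 < T → ClusterConsensus.ZeroSumPeriodic T u →
      ∀ x : ℕ → Fin n → ℝ, ClusterConsensus.IsTrajectory c A α u x →
        ∃ v : ℕ → Fin n → ℝ, ClusterConsensus.IsTrajectory c A α u v ∧
          Function.Periodic v T ∧ Tendsto (fun t => x t - v t) atTop (𝓝 0)) := by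
  refine ⟨fun A B h α u _ hS x hx => ?_, fun T hT => ?_, fun A B h T α u hT hu x hx => ?_⟩
  · obtain ⟨C, hC⟩ := hS.exists_norm_le
    refine h.isBounded_range hc (C := C) (fun t => ?_) hx
    rcases t with _ | t
    · simpa using (norm_nonneg _).trans (hC _ (Set.mem_range_self 0))
    · exact hC _ (Set.mem_range_self t)
  · refine measure_mono_null (Set.image_mono ?_)
      (ClusterConsensus.forAlmostEveryTriple_reachesClusterConsensus hc Υ hT)
    rintro z ⟨hz, hbad⟩
    refine ⟨hz, fun hall => hbad ?_⟩
    -- Consensus holds from every initial state, not merely almost every one.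
    exact fun A h => Eventually.of_forall fun _ x hx _ => hall A h x hx
  · obtain ⟨y, hy, hper⟩ := ClusterConsensus.exists_periodic_reduced h.influence_stochastic
      (h.influence_diag_pos hc) α hT hu
    obtain ⟨η, hBη, hη⟩ := h.exists_limit_sub_reduced hc hx hy
    -- Shifting `y` by the fixed vector `η` of `B` keeps it a periodic reduced solution and absorbs
    -- the limit of `x t - y t ∘ c`.
    refine ⟨fun t => (y t + η) ∘ c, h.isTrajectory_comp (y := fun t => y t + η) fun t => ?_,
      fun t => by simp only [hper t], ?_⟩
    · rw [hy, Matrix.mulVec_add, hBη]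
      abel
    · have h1 := hη.sub_const (η ∘ c)
      rw [sub_self] at h1
      refine h1.congr fun t => ?_
      ext i
      simp only [Pi.sub_apply, Function.comp_apply, Pi.add_apply]
      ring
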